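/- **Setting.** Fix \(d\) and \(\beta>0\). A polynomial \(p\) in \(n\) real variables of degree at most \(d\) is *\(\beta\)-smooth* if for all \(0\le l\le d\) every coefficient of a monomial of degree \(l\) is at most \(\beta n^{d-l}\) in absolute value; it is *multilinear* if it is affine in each variable when the others are fixed. *Decomposition.* Write \(p(x)=c+\sum_{j=1}^n x_j\,p_j(x)\), where for \(j=1,\dots,n\) in turn \(p_j\) is the coefficient of \(x_j\) in what is left of \(p\) (that is, \(x_jp_j\) collects the remaining monomials that contain \(x_j\)), and \(c\) is constant. Applying this recursively gives polynomials \(p_I\) for index tuples \(I\), with \(p_I=c_I+\sum_j x_j\,p_{I,j}\). *Relaxation.* For a prediction \(\hat x\in\{0,1\}^n\) let \(q_I(x)=c_I+\sum_j x_j\,p_{I,j}(\hat x)\). For an error budget \(\varepsilon\) the linear program \(\mathrm{LP}(p,\hat x,\varepsilon)\) is to maximize \(c+\sum_j x_j\,p_j(\hat x)\) over \(x\in[0,1]^n\) subject to \(|q_I(x)-p_I(\hat x)|\le\delta_I\) for all \(I\) with \(1\le|I|\le d-1\), where \(\delta_I=2\beta e\,n^{d-|I|-1/2}\sqrt{\varepsilon}\)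 if \(|I|<d-1\) and \(\delta_I=\beta\sqrt{n\varepsilon}\) if \(|I|=d-1\). *Algorithm \(\mathcal A_f\).* For an instance \(\pi\) with objective \(p=p^\pi\) and oracle prediction \(\hat x=f(\pi)\): for each \(\varepsilon\in\{0,1,\dots,n\}\) compute an optimal solution \(y\) of \(\mathrm{LP}(p,\hat x,\varepsilon)\) (any LP solver may be used) and round it to \(z\in\{0,1\}^n\), either by *randomized rounding* (independently \(z_i=1\) with probability \(y_i\), with fresh coins for each \(\varepsilon\)) or by *greedy rounding* (for \(i=1,\dots,n\) in turn replace \(y_i\) by a value in \(\{0,1\}\) that maximizes \(p\) with all other current coordinates fixed). Return the best of the \(n+1\) rounded vectors, \(z_f(\pi)\). *Learning.* Let \(\Pi\) be a space of such instances, with common \(n,d,\beta\) and \(\beta\)-smooth objectives \(p^\pi\) of degree at most \(d\) that are to be maximized over \(\{0,1\}^n\). Let \(\mathcal D\) be a probability distribution on \(\Pi\), \(x^*(\pi)\) an optimal solution of \(\pi\), \(H\) an upper bound on all optimal values, and \(\mathcal F\) a class of oracles \(f:\Pi\to\{0,1\}^n\). Put \[\mathcal P(f)=\mathbb E[p^\pi(z_f(\pi))],\quad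 \mathcal P^*=\mathbb E[p^\pi(x^*(\pi))],\quad R(f)=\mathbb E[H-p^\pi(z_f(\pi))],\quad \mathcal E(f)=\mathbb E\|f(\pi)-x^*(\pi)\|_1,\] where the expectations are over \(\pi\sim\mathcal D\) and the coins of the rounding. Let \(f^*_{\mathrm{cost}}\) minimize \(R\) over \(\mathcal F\), let \(f^*_{\mathrm{pred}}\) minimize \(\mathcal E\) over \(\mathcal F\), and let \(\varepsilon_{\mathcal F}=\mathcal E(f^*_{\mathrm{pred}})\). **Proposition.** There is a constant \(K>0\) that depends only on \(d\) and \(\beta\) such that, for all \(n\), \(\Pi\), \(\mathcal D\), \(\mathcal F\) as above: 1. if randomized rounding is used, then \[\mathcal P(f^*_{\mathrm{cost}})\ \ge\ \mathcal P^*-K\left(n^{d-1/2}\sqrt{\varepsilon_{\mathcal F}}+n^{d-1}\right);\] 2. if all objectives are multilinear, then with either rounding strategy \[\mathcal P(f^*_{\mathrm{cost}})\ \ge\ \mathcal P^*-K\,n^{d-1/2}\sqrt{\varepsilon_{\mathcal F}}.\] -/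

import Mathlib

open MeasureTheory

noncomputable section

namespace SmoothIP

variable {n : ℕ}

/-- `p` has degree at most `d` and is `β`-smooth: every coefficient of a degree-`l` monomial,
`0 ≤ l ≤ d`, is at most `β * n ^ (d - l)` in absolute value. -/
def IsSmooth (β : ℝ) (d : ℕ) (p : MvPolynomial (Fin n) ℝ) : Prop :=
  p.totalDegree ≤ d ∧
    ∀ m : Fin n →₀ ℕ, m.degree ≤ d → |p.coeff m| ≤ β * (n : ℝ) ^ (d - m.degree)

/-- `p` is affine in each variable when the other variables are held fixed. -/
def IsMultilinear (p : MvPolynomial (Fin n) ℝ) : Prop :=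
  ∀ (k : Fin n) (x : Fin n → ℝ), ∃ a b : ℝ, ∀ t : ℝ,
    MvPolynomial.eval (Function.update x k t) p = a * t + b

/-- A Boolean vector as a real 0/1 vector. -/
def boolVec (x : Fin n → Bool) : Fin n → ℝ := fun i => if x i then 1 else 0

/-- The value of the objective `p` at a Boolean vector. -/
def objective (p : MvPolynomial (Fin n) ℝ) (x : Fin n → Bool) : ℝ :=
  MvPolynomial.eval (boolVec x) p

/-- `x` is an optimal solution of `max p` over `{0,1}^n`. -/
def IsOptimalSolution (p : MvPolynomial (Fin n) ℝ) (x : Fin n → Bool) : Prop :=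
  ∀ x' : Fin n → Bool, objective p x' ≤ objective p x

/-! ### Decomposition of a polynomial -/

/-- What is left of `p` in the decomposition loop after its first `k` variables have been
processed: processing `x_i` removes all monomials that contain `x_i`. -/
def remainder (p : MvPolynomial (Fin n) ℝ) (k : ℕ) : MvPolynomial (Fin n) ℝ :=
  ((List.finRange n).take k).foldl (fun r i => r.modMonomial (Finsupp.single i 1)) p

/-- The component `p_j`: the quotient by `x_j` of what is left when the loop reaches `x_j`. Then
`p = c + ∑ j, x_j * p_j`, where `c` is the constant term of `p`. -/
def component (p : MvPolynomial (Fin n) ℝ) (j : Fin n) : MvPolynomial (Fin n) ℝ :=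
  (remainder p j).divMonomial (Finsupp.single j 1)

/-- The component `p_I` for an index tuple `I = (i_1, …, i_k)`, obtained by decomposing
recursively. It is the zero polynomial if the recursion never produces the tuple `I`. -/
def componentAt (p : MvPolynomial (Fin n) ℝ) : List (Fin n) → MvPolynomial (Fin n) ℝ
  | [] => p
  | j :: I => componentAt (component p j) I

/-- The linear approximation `q(x) = c + ∑ j, x_j * p_j(xhat)` of `p` around `xhat`. -/
def linearize (p : MvPolynomial (Fin n) ℝ) (xhat : Fin n → Bool) (x : Fin n → ℝ) : ℝ :=
  MvPolynomial.constantCoeff p + ∑ j, x j * objective (component p j) xhat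

/-! ### The linear programming relaxation -/

/-- The tolerance `δ_I` for a tuple `I` of length `k` and the error budget `ε`. -/
def tolerance (n : ℕ) (β : ℝ) (d : ℕ) (ε : ℝ) (k : ℕ) : ℝ :=
  if k + 1 < d then
    2 * β * Real.exp 1 * (n : ℝ) ^ ((d : ℝ) - (k : ℝ) - 1 / 2) * √ε
  else
    β * √((n : ℝ) * ε)

/-- The feasible set of the relaxation: `x ∈ [0,1]^n` and `|q_I(x) - p_I(xhat)| ≤ δ_I` for all
index tuples `I` with `1 ≤ |I| ≤ d - 1`. (If `|I| ≥ d`, then `p_I` is constant and equal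
to `q_I`, so the constraint is void; it is also void if `p_I = 0`.) -/
def relaxFeasible (β : ℝ) (d : ℕ) (p : MvPolynomial (Fin n) ℝ) (xhat : Fin n → Bool) (ε : ℝ) :
    Set (Fin n → ℝ) :=
  {x | (∀ i, 0 ≤ x i ∧ x i ≤ 1) ∧
    ∀ I : List (Fin n), 1 ≤ I.length → I.length < d →
      |linearize (componentAt p I) xhat x - objective (componentAt p I) xhat| ≤
        tolerance n β d ε I.length}

/-- `y` is an optimal solution of the linear program: maximize `c + ∑ j, x_j * p_j(xhat)` over
the feasible set. -/
def IsRelaxOptimal (β : ℝ) (d : ℕ) (p : MvPolynomial (Fin n) ℝ) (xhat : Fin n → Bool) (ε : ℝ)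
    (y : Fin n → ℝ) : Prop :=
  y ∈ relaxFeasible β d p xhat ε ∧ IsMaxOn (linearize p xhat) (relaxFeasible β d p xhat ε) y

/-! ### Rounding -/

/-- The probability that independent randomized rounding of `y` returns `z`: coordinate `i`
becomes `1` with probability `y i`. -/
def roundingProb (y : Fin n → ℝ) (z : Fin n → Bool) : ℝ :=
  ∏ i, if z i then y i else 1 - y i

open Classical in
/-- One step of greedy rounding: coordinate `i` is set to a value `t ∈ {0,1}` that maximizes `p`
with the other coordinates fixed; if both values do, to the one given by `tie i`. -/
def greedyStep (tie : Fin n → Bool) (p : MvPolynomial (Fin n) ℝ) (y : Fin n → ℝ) (i : Fin n) :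
    Fin n → ℝ :=
  let g : ℝ → ℝ := fun t => MvPolynomial.eval (Function.update y i t) p
  if g 0 < g 1 ∨ (g 0 = g 1 ∧ tie i = true) then Function.update y i 1
  else Function.update y i 0

/-- Greedy deterministic rounding of `y`, coordinate after coordinate. -/
def greedyRound (tie : Fin n → Bool) (p : MvPolynomial (Fin n) ℝ) (y : Fin n → ℝ) : Fin n → ℝ :=
  (List.finRange n).foldl (greedyStep tie p) y

/-- The two rounding strategies; the greedy one comes with its rule for ties. -/
inductive Strategy (n : ℕ) : Type
  | randomized : Strategy n
  | greedy (tie : Fin n → Bool) : Strategy n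

/-! ### The pipeline and its performance -/

/-- The best objective value among the candidates `z_0, …, z_n`. -/
def bestValue (p : MvPolynomial (Fin n) ℝ) (z : Fin (n + 1) → Fin n → ℝ) : ℝ :=
  Finset.univ.sup' Finset.univ_nonempty fun e => MvPolynomial.eval (z e) p

/-- The (expected, if the rounding is randomized) objective value of the output of the pipeline,
where `y e` is the solution of the relaxation with error budget `e ∈ {0, …, n}`: every `y e` is
rounded, with independent coins, and the best of the `n + 1` rounded vectors is returned. -/
def pipelineValue (p : MvPolynomial (Fin n) ℝ) (y : Fin (n + 1) → Fin n → ℝ) : Strategy n → ℝ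
  | .randomized =>
      ∑ z : Fin (n + 1) → Fin n → Bool,
        (∏ e, roundingProb (y e) (z e)) * bestValue p (fun e => boolVec (z e))
  | .greedy tie => bestValue p (fun e => greedyRound tie p (y e))

section Learning

variable {Inst : Type*} [MeasurableSpace Inst]

/-- `𝒫(f)`, the expected objective value attained with the oracle `f`; `y π xhat e` is the solution
returned by the solver for the relaxation of the instance `π` with prediction `xhat` and
error budget `e`. -/
def expectedObjective (D : Measure Inst) (p : Inst → MvPolynomial (Fin n) ℝ)
    (y : Inst → (Fin n → Bool) → Fin (n + 1) → Fin n → ℝ) (s : Strategy n)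
    (f : Inst → Fin n → Bool) : ℝ :=
  ∫ π, pipelineValue (p π) (y π (f π)) s ∂D

/-- `R(f)`, the expected cost `H - (objective value)` of the pipeline with the oracle `f`. -/
def risk (D : Measure Inst) (H : ℝ) (p : Inst → MvPolynomial (Fin n) ℝ)
    (y : Inst → (Fin n → Bool) → Fin (n + 1) → Fin n → ℝ) (s : Strategy n)
    (f : Inst → Fin n → Bool) : ℝ :=
  ∫ π, (H - pipelineValue (p π) (y π (f π)) s) ∂D

/-- `𝒫*`, the expected optimal objective value. -/
def optimalObjective (D : Measure Inst) (p : Inst → MvPolynomial (Fin n) ℝ)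
    (xstar : Inst → Fin n → Bool) : ℝ :=
  ∫ π, objective (p π) (xstar π) ∂D

/-- `ℰ(f)`, the expected `L¹` prediction error of the oracle `f`. -/
def predictionError (D : Measure Inst) (xstar f : Inst → Fin n → Bool) : ℝ :=
  ∫ π, ∑ i, |boolVec (f π) i - boolVec (xstar π) i| ∂D

end Learning

end SmoothIP

end

noncomputable section

namespace SmoothIP

variable {n : ℕ}

/-! ### Monomials of given degree -/

/-! The bound is proved instance by instance and then averaged. Let ε be the Hamming distance from
the prediction to the optimum x*. It is an integer in {0, …, n}, so one of the budgets equals it.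

For this budget x* is feasible (`boolVec_mem_relaxFeasible`): q_I(x*) - p_I(xhat) is a sum over the
ε coordinates that differ, each term is at most max |p_{I,j}(xhat)|, and ε ≤ √(nε). The size of
p_{I,j} comes from counting monomials, and the count fits the prescribed constant 2βe once n ≥ 2d².
Conversely, at every feasible point p is close to its linearization, since the tolerances add up
along the recursive decomposition (`abs_eval_sub_objective_le`). Hence the solution of this
relaxation loses O(n^(d-1/2) √ε) against x* (`IsRelaxOptimal.objective_sub_le`). If n < 2d² and ε ≥
1, the trivial bound O(n^d) is already of this order, with a constant depending on d and β.

Randomized rounding changes the expectation only on monomials that are not squarefree; there are at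
most n^(l-1) of them in degree l, which costs O(n^(d-1)). For a multilinear objective randomized
rounding is unbiased and greedy rounding never decreases the value.

Finally, minimal risk means that the cost oracle earns at least what the prediction oracle earns,
and Jensen's inequality for the square root moves the expectation inside. -/

/-- The exponents of the monomials of degree `l` in `n` variables. -/
def exponents (n l : ℕ) : Finset (Fin n →₀ ℕ) := Finset.finsuppAntidiag Finset.univ l

lemma mem_exponents {l : ℕ} {m : Fin n →₀ ℕ} : m ∈ exponents n l ↔ m.degree = l := by
  simp [exponents, Finsupp.degree_eq_sum]

lemma card_exponents (l : ℕ) : (exponents n l).card = (n + l - 1).choose l := by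
  simp [exponents, Finset.card_finsuppAntidiag_nat_eq_choose]

lemma card_exponents_le (l : ℕ) : (exponents n l).card ≤ n ^ l := by
  rw [card_exponents]
  -- For n = 0 the subtraction in n + l - 1 is truncated when l = 0.
  rcases n with _ | n
  · rcases l with _ | l
    · simp
    · simp
  · have h : n + 1 + l - 1 = n + l := by omega
    rw [h]
    exact Nat.choose_add_le_add_one_pow n l

/-- The binomial is at most (n + d)^l / l!, and (1 + d/n)^l ≤ exp(dl/n) ≤ exp(1/2) ≤ 2 when 2d² ≤ n.
Keeping the 1/l! is what later sums to e. -/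
lemma card_exponents_le_of_two_mul_sq_le {d l : ℕ} (hl : l ≤ d) (hn : 2 * d ^ 2 ≤ n) :
    ((exponents n l).card : ℝ) ≤ 2 * (n : ℝ) ^ l * (1 / (l.factorial : ℝ)) := by
  rcases Nat.eq_zero_or_pos d with rfl | hd
  · obtain rfl : l = 0 := by omega
    simp [card_exponents]
  have hd1 : 1 ≤ d ^ 2 := Nat.one_le_pow _ _ hd
  have hn0 : (0 : ℝ) < n := by exact_mod_cast (by omega : 0 < n)
  have hle : n + l - 1 ≤ n + d := by omega
  have hexp : Real.exp (1 / 2) ≤ 2 := by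
    have h1 : Real.exp (1 / 2) ^ 2 = Real.exp 1 := by
      rw [← Real.exp_nat_mul]; norm_num
    have h2 := Real.exp_one_lt_d9
    nlinarith [Real.exp_pos (1 / 2)]
  have hpow : ((n : ℝ) + d) ^ l ≤ 2 * (n : ℝ) ^ l := by
    calc ((n : ℝ) + d) ^ l = (d / n + 1) ^ l * (n : ℝ) ^ l := by
          rw [← mul_pow]; congr 1; field_simp; ring
      _ ≤ Real.exp (d / n) ^ l * (n : ℝ) ^ l := by
          gcongr; exact Real.add_one_le_exp _
      _ ≤ 2 * (n : ℝ) ^ l := by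
          gcongr
          rw [← Real.exp_nat_mul]
          refine (Real.exp_le_exp.2 ?_).trans hexp
          have h1 : (2 : ℝ) * d ^ 2 ≤ n := by exact_mod_cast hn
          have h2 : (l : ℝ) ≤ d := by exact_mod_cast hl
          rw [← mul_div_assoc, div_le_div_iff₀ hn0 two_pos]
          nlinarith [mul_le_mul_of_nonneg_right h2 (Nat.cast_nonneg (α := ℝ) d)]
  rw [card_exponents, mul_one_div]
  refine (Nat.choose_le_pow_div l (n + l - 1)).trans ?_
  gcongr
  refine le_trans ?_ hpow
  gcongr
  exact_mod_cast hle

lemma eval_eq_sum_exponents {d : ℕ} {p : MvPolynomial (Fin n) ℝ} (hp : p.totalDegree ≤ d)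
    (x : Fin n → ℝ) :
    MvPolynomial.eval x p =
      ∑ l ∈ Finset.range (d + 1), ∑ m ∈ exponents n l, p.coeff m * ∏ i, x i ^ m i := by
  rw [MvPolynomial.eval_eq', ← Finset.sum_biUnion]
  · refine Finset.sum_subset (fun m hm => ?_) (fun m _ hm => ?_)
    · have := MvPolynomial.le_totalDegree hm
      simp only [Finset.mem_biUnion, Finset.mem_range, mem_exponents]
      refine ⟨_, ?_, rfl⟩
      have h : m.degree = m.sum fun _ e => e := rfl
      omega
    · rw [MvPolynomial.notMem_support_iff.1 hm, zero_mul]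
  · intro a _ b _ hab
    refine Finset.disjoint_left.2 fun m ha hb => hab ?_
    rw [← mem_exponents.1 ha, ← mem_exponents.1 hb]

lemma IsSmooth.abs_eval_le_sum {β : ℝ} {d : ℕ} {p : MvPolynomial (Fin n) ℝ} (hp : IsSmooth β d p)
    {x : Fin n → ℝ} (hx : ∀ i, 0 ≤ x i ∧ x i ≤ 1) :
    |MvPolynomial.eval x p| ≤
      ∑ l ∈ Finset.range (d + 1), ((exponents n l).card : ℝ) * (β * (n : ℝ) ^ (d - l)) := by
  rw [eval_eq_sum_exponents hp.1]
  refine (Finset.abs_sum_le_sum_abs _ _).trans (Finset.sum_le_sum fun l hl => ?_)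
  rw [← nsmul_eq_mul]
  refine (Finset.abs_sum_le_sum_abs _ _).trans (Finset.sum_le_card_nsmul _ _ _ fun m hm => ?_)
  rw [Finset.mem_range] at hl
  have hm' := mem_exponents.1 hm
  have h := hp.2 m (by omega)
  rw [hm'] at h
  rw [abs_mul]
  refine (mul_le_of_le_one_right (abs_nonneg _) ?_).trans h
  rw [abs_of_nonneg (Finset.prod_nonneg fun i _ => pow_nonneg (hx i).1 _)]
  exact Finset.prod_le_one (fun i _ => pow_nonneg (hx i).1 _)
    fun i _ => pow_le_one₀ (hx i).1 (hx i).2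

lemma IsSmooth.abs_eval_le {β : ℝ} (hβ : 0 ≤ β) {d : ℕ} {p : MvPolynomial (Fin n) ℝ}
    (hp : IsSmooth β d p) {x : Fin n → ℝ} (hx : ∀ i, 0 ≤ x i ∧ x i ≤ 1) :
    |MvPolynomial.eval x p| ≤ (d + 1) * β * (n : ℝ) ^ d := by
  refine (hp.abs_eval_le_sum hx).trans ?_
  calc _ ≤ ∑ l ∈ Finset.range (d + 1), β * (n : ℝ) ^ d := by
        refine Finset.sum_le_sum fun l hl => ?_
        rw [Finset.mem_range] at hl
        have h : ((exponents n l).card : ℝ) ≤ (n : ℝ) ^ l := by exact_mod_cast card_exponents_le l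
        calc _ ≤ (n : ℝ) ^ l * (β * (n : ℝ) ^ (d - l)) := by gcongr
          _ = β * ((n : ℝ) ^ l * (n : ℝ) ^ (d - l)) := by ring
          _ = _ := by rw [← pow_add, Nat.add_sub_cancel' (by omega)]
    _ = _ := by simp; ring

/-- Unlike the factor d + 1 of `IsSmooth.abs_eval_le`, the factor 2e does not grow with d, as the
constant in `tolerance` demands. It is a partial sum of the exponential series at 1, doubled. -/
lemma IsSmooth.abs_eval_le_of_two_mul_sq_le {β : ℝ} (hβ : 0 ≤ β) {d : ℕ}
    {p : MvPolynomial (Fin n) ℝ} (hp : IsSmooth β d p) {x : Fin n → ℝ}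
    (hx : ∀ i, 0 ≤ x i ∧ x i ≤ 1) (hn : 2 * d ^ 2 ≤ n) :
    |MvPolynomial.eval x p| ≤ 2 * β * Real.exp 1 * (n : ℝ) ^ d := by
  refine (hp.abs_eval_le_sum hx).trans ?_
  calc _ ≤ ∑ l ∈ Finset.range (d + 1), 2 * β * (n : ℝ) ^ d * (1 ^ l / (l.factorial : ℝ)) := by
        refine Finset.sum_le_sum fun l hl => ?_
        rw [Finset.mem_range] at hl
        have h := card_exponents_le_of_two_mul_sq_le (n := n) (l := l) (by omega) hn
        calc _ ≤ 2 * (n : ℝ) ^ l * (1 / (l.factorial : ℝ)) * (β * (n : ℝ) ^ (d - l)) := by gcongr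
          _ = 2 * β * ((n : ℝ) ^ l * (n : ℝ) ^ (d - l)) * (1 / (l.factorial : ℝ)) := by ring
          _ = _ := by rw [← pow_add, Nat.add_sub_cancel' (by omega), one_pow]
    _ = 2 * β * (n : ℝ) ^ d * ∑ l ∈ Finset.range (d + 1), (1 ^ l / (l.factorial : ℝ)) := by
        rw [Finset.mul_sum]
    _ ≤ 2 * β * (n : ℝ) ^ d * Real.exp 1 := by
        gcongr
        exact Real.sum_le_exp_of_nonneg zero_le_one _
    _ = _ := by ring

/-! ### The decomposition -/

lemma coeff_foldl_modMonomial (L : List (Fin n)) (p : MvPolynomial (Fin n) ℝ) (m : Fin n →₀ ℕ) :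
    (L.foldl (fun r i => r.modMonomial (Finsupp.single i 1)) p).coeff m =
      if ∀ i ∈ L, m i = 0 then p.coeff m else 0 := by
  induction L generalizing p with
  | nil => simp
  | cons j L ih =>
    rw [List.foldl_cons, ih]
    by_cases hj : m j = 0
    · rw [MvPolynomial.coeff_modMonomial_of_not_le]
      · simp [hj]
      · simp [hj]
    · rw [MvPolynomial.coeff_modMonomial_of_le]
      · simp [hj]
      · simp; omega

lemma coeff_remainder (p : MvPolynomial (Fin n) ℝ) (k : ℕ) (m : Fin n →₀ ℕ) :
    (remainder p k).coeff m =
      if ∀ i ∈ (List.finRange n).take k, m i = 0 then p.coeff m else 0 :=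
  coeff_foldl_modMonomial _ _ _

lemma remainder_succ (p : MvPolynomial (Fin n) ℝ) (j : Fin n) :
    remainder p (j + 1) = (remainder p j).modMonomial (Finsupp.single j 1) := by
  simp [remainder, List.take_add_one]

lemma remainder_self (p : MvPolynomial (Fin n) ℝ) :
    remainder p n = MvPolynomial.C (MvPolynomial.constantCoeff p) := by
  ext m
  rw [coeff_remainder, MvPolynomial.coeff_C]
  have : (∀ i ∈ (List.finRange n).take n, m i = 0) ↔ 0 = m := by
    rw [List.take_of_length_le (by simp)]
    simp [Finsupp.ext_iff, eq_comm]
  simp only [this]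
  split_ifs with h
  · subst h; rfl
  · rfl

/-- Division with remainder by x_j makes each term x_j p_j the difference of two consecutive
remainders, so the sum telescopes from p down to its constant term. -/
lemma eval_eq_linear_combination (p : MvPolynomial (Fin n) ℝ) (x : Fin n → ℝ) :
    MvPolynomial.eval x p = MvPolynomial.constantCoeff p +
      ∑ j, x j * MvPolynomial.eval x (component p j) := by
  have key : ∀ j : Fin n, x j * MvPolynomial.eval x (component p j) =
      MvPolynomial.eval x (remainder p j) - MvPolynomial.eval x (remainder p (j + 1)) := by
    intro j
    have h := congrArg (MvPolynomial.eval x)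
      (MvPolynomial.divMonomial_add_modMonomial_single (remainder p j) j)
    rw [map_add, map_mul, MvPolynomial.eval_X, ← remainder_succ] at h
    rw [component]
    linarith
  simp only [key]
  rw [Fin.sum_univ_eq_sum_range (fun k => MvPolynomial.eval x (remainder p k) -
    MvPolynomial.eval x (remainder p (k + 1))) n, Finset.sum_range_sub', remainder_self]
  simp [remainder]

/-- The decomposition only moves or deletes coefficients. Degree and exponent of n drop together,
which is why smoothness is inherited with d lowered by one. -/
lemma coeff_component (p : MvPolynomial (Fin n) ℝ) (j : Fin n) (m : Fin n →₀ ℕ) :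
    (component p j).coeff m = p.coeff (Finsupp.single j 1 + m) ∨ (component p j).coeff m = 0 := by
  rw [component, MvPolynomial.coeff_divMonomial, coeff_remainder]
  split_ifs <;> simp

lemma totalDegree_component_le {d : ℕ} {p : MvPolynomial (Fin n) ℝ} (hp : p.totalDegree ≤ d)
    (j : Fin n) : (component p j).totalDegree ≤ d - 1 := by
  refine Finset.sup_le fun m hm => ?_
  rw [MvPolynomial.mem_support_iff] at hm
  have h := (coeff_component p j m).resolve_right hm
  rw [h, ← MvPolynomial.mem_support_iff] at hm
  have h2 : (Finsupp.single j 1 + m).degree ≤ _ := MvPolynomial.le_totalDegree hm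
  rw [map_add, Finsupp.degree_single] at h2
  have h3 : m.degree = m.sum fun _ e => e := rfl
  omega

lemma IsSmooth.component {β : ℝ} (hβ : 0 ≤ β) {d : ℕ} {p : MvPolynomial (Fin n) ℝ}
    (hp : IsSmooth β (d + 1) p) (j : Fin n) : IsSmooth β d (component p j) := by
  refine ⟨totalDegree_component_le hp.1 j, fun m hm => ?_⟩
  rcases coeff_component p j m with h | h
  · rw [h]
    have h2 := hp.2 (Finsupp.single j 1 + m) (by rw [map_add, Finsupp.degree_single]; omega)
    rw [map_add, Finsupp.degree_single] at h2
    rwa [show d + 1 - (1 + m.degree) = d - m.degree by omega] at h2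
  · rw [h, abs_zero]
    positivity

lemma IsSmooth.componentAt {β : ℝ} (hβ : 0 ≤ β) (I : List (Fin n)) :
    ∀ {d : ℕ} {p : MvPolynomial (Fin n) ℝ}, IsSmooth β (d + I.length) p →
      IsSmooth β d (componentAt p I) := by
  induction I with
  | nil => exact fun h => h
  | cons j I ih =>
    intro d p hp
    exact ih (IsSmooth.component hβ (by rwa [List.length_cons, ← add_assoc] at hp) j)

/-! ### The relaxation -/

lemma boolVec_mem (x : Fin n → Bool) (i : Fin n) : 0 ≤ boolVec x i ∧ boolVec x i ≤ 1 := by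
  unfold boolVec
  split_ifs <;> norm_num

/-- The Hamming distance of two Boolean vectors, as their distance in the `L¹` norm. -/
def boolDist (x x' : Fin n → Bool) : ℝ := ∑ i, |boolVec x i - boolVec x' i|

lemma boolDist_eq_card (x x' : Fin n → Bool) :
    boolDist x x' = (Finset.univ.filter fun i => x i ≠ x' i).card := by
  rw [boolDist, Finset.card_filter, Nat.cast_sum]
  refine Finset.sum_congr rfl fun i _ => ?_
  unfold boolVec
  cases x i <;> cases x' i <;> simp

lemma boolDist_nonneg (x x' : Fin n → Bool) : 0 ≤ boolDist x x' :=
  Finset.sum_nonneg fun _ _ => abs_nonneg _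

lemma exists_eq_boolDist (x x' : Fin n → Bool) :
    ∃ e : Fin (n + 1), ((e : ℕ) : ℝ) = boolDist x x' := by
  refine ⟨⟨(Finset.univ.filter fun i => x i ≠ x' i).card, ?_⟩, (boolDist_eq_card x x').symm⟩
  have := Finset.card_filter_le (Finset.univ : Finset (Fin n)) (fun i => x i ≠ x' i)
  simp only [Finset.card_univ, Fintype.card_fin] at this
  omega

lemma boolDist_le (x x' : Fin n → Bool) : boolDist x x' ≤ n := by
  obtain ⟨e, he⟩ := exists_eq_boolDist x x'
  rw [← he]
  exact_mod_cast Nat.lt_succ_iff.1 e.2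

lemma tolerance_nonneg {β : ℝ} (hβ : 0 ≤ β) (d : ℕ) (ε : ℝ) (k : ℕ) :
    0 ≤ tolerance n β d ε k := by
  unfold tolerance
  split_ifs <;> positivity

/-- The unit in which linearization errors are measured. -/
def errorUnit (n : ℕ) (β ε : ℝ) : ℝ := 2 * β * Real.exp 1 * √ε / √n

lemma errorUnit_nonneg {β : ℝ} (hβ : 0 ≤ β) (ε : ℝ) : 0 ≤ errorUnit n β ε := by
  unfold errorUnit
  positivity

/-- In this form all tolerances scale like n^(d-k) with one common factor, so the recursion over
tuples closes up. For k + 1 < d it is an equality; at the last level it uses 1 ≤ 2e. -/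
lemma tolerance_le {β ε : ℝ} (hβ : 0 ≤ β) (hεn : ε ≤ n) {d k : ℕ} (hk : k < d) :
    tolerance n β d ε k ≤ errorUnit n β ε * (n : ℝ) ^ (d - k) := by
  -- The bound ε ≤ n matters only here: it forces √ε = 0 when n = 0.
  rcases Nat.eq_zero_or_pos n with rfl | hn
  · have h : √ε = 0 := Real.sqrt_eq_zero_of_nonpos (by simpa using hεn)
    simp [tolerance, h, errorUnit]
  have hn' : (0 : ℝ) < n := by exact_mod_cast hn
  have hs : (0 : ℝ) < √n := Real.sqrt_pos.2 hn'
  unfold tolerance errorUnit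
  split_ifs with h
  · have e : (d : ℝ) - k - 1 / 2 = ((d - k : ℕ) : ℝ) - 1 / 2 := by rw [Nat.cast_sub hk.le]
    rw [e, Real.rpow_sub hn', Real.rpow_natCast, ← Real.sqrt_eq_rpow]
    apply le_of_eq
    ring
  · obtain rfl : d = k + 1 := by omega
    have e2 : (1 : ℝ) ≤ 2 * Real.exp 1 := by
      have := Real.add_one_le_exp (1 : ℝ)
      linarith
    rw [Real.sqrt_mul hn'.le, Nat.add_sub_cancel_left, pow_one, div_mul_eq_mul_div, le_div_iff₀ hs]
    calc β * (√n * √ε) * √n = 1 * (β * √ε) * (√n * √n) := by ring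
      _ = 1 * (β * √ε) * n := by rw [Real.mul_self_sqrt hn'.le]
      _ ≤ (2 * Real.exp 1) * (β * √ε) * n := by gcongr
      _ = _ := by ring

lemma abs_linearize_sub_objective_le {q : MvPolynomial (Fin n) ℝ} {xhat x : Fin n → Bool} {B : ℝ}
    (hB : ∀ j, |objective (component q j) xhat| ≤ B) :
    |linearize q xhat (boolVec x) - objective q xhat| ≤ boolDist xhat x * B := by
  have h : linearize q xhat (boolVec x) - objective q xhat =
      ∑ j, (boolVec x j - boolVec xhat j) * objective (component q j) xhat := by
    have := eval_eq_linear_combination q (boolVec xhat)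
    simp only [linearize, objective] at this ⊢
    rw [this, add_sub_add_left_eq_sub, ← Finset.sum_sub_distrib]
    exact Finset.sum_congr rfl fun j _ => by ring
  rw [h, boolDist, Finset.sum_mul]
  refine (Finset.abs_sum_le_sum_abs _ _).trans (Finset.sum_le_sum fun j _ => ?_)
  rw [abs_mul, abs_sub_comm]
  exact mul_le_mul_of_nonneg_left (hB j) (abs_nonneg _)

/-- At distance zero every deviation vanishes, so no lower bound on n is needed there. Otherwise n ≥
2d² bounds the components sharply enough for the prescribed tolerances. -/
lemma boolVec_mem_relaxFeasible {β : ℝ} (hβ : 0 ≤ β) {d : ℕ} {p : MvPolynomial (Fin n) ℝ}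
    (hp : IsSmooth β d p) (xhat x : Fin n → Bool)
    (h : boolDist xhat x = 0 ∨ 2 * d ^ 2 ≤ n) :
    boolVec x ∈ relaxFeasible β d p xhat (boolDist xhat x) := by
  refine ⟨boolVec_mem x, fun I _ hI => ?_⟩
  -- D bounds the degree of the components one level below I.
  obtain ⟨D, rfl⟩ : ∃ D, d = D + 1 + I.length := ⟨d - 1 - I.length, by omega⟩
  have hc : ∀ j, IsSmooth β D (component (componentAt p I) j) :=
    (IsSmooth.componentAt hβ I hp).component hβ
  rcases h with h | h
  · refine (abs_linearize_sub_objective_le fun j => (hc j).abs_eval_le hβ (boolVec_mem xhat)).trans ?_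
    rw [h, zero_mul]
    exact tolerance_nonneg hβ _ _ _
  have hd := boolDist_nonneg xhat x
  -- Trading ε for √n √ε produces the exponent d - |I| - 1/2 of the tolerance.
  have hε : boolDist xhat x ≤ √n * √(boolDist xhat x) :=
    calc boolDist xhat x = √(boolDist xhat x) * √(boolDist xhat x) := (Real.mul_self_sqrt hd).symm
      _ ≤ _ := by gcongr; exact boolDist_le _ _
  unfold tolerance
  split_ifs with hD
  · refine (abs_linearize_sub_objective_le fun j =>
      (hc j).abs_eval_le_of_two_mul_sq_le hβ (boolVec_mem xhat) ?_).trans ?_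
    · refine le_trans ?_ h
      gcongr
      omega
    have hn : 0 < n := lt_of_lt_of_le (by positivity) h
    have hn' : (0 : ℝ) < n := by exact_mod_cast hn
    have e : ((D + 1 + I.length : ℕ) : ℝ) - I.length - 1 / 2 = (D : ℝ) + 1 / 2 := by
      push_cast; ring
    rw [e, Real.rpow_add hn', Real.rpow_natCast, ← Real.sqrt_eq_rpow]
    calc _ ≤ √n * √(boolDist xhat x) * (2 * β * Real.exp 1 * (n : ℝ) ^ D) := by gcongr
      _ = _ := by ring
  -- Below the last level the components are constants of size at most β, so the smaller tolerance
  -- suffices.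
  · obtain rfl : D = 0 := by omega
    refine (abs_linearize_sub_objective_le fun j => (hc j).abs_eval_le hβ (boolVec_mem xhat)).trans ?_
    rw [Real.sqrt_mul (Nat.cast_nonneg n)]
    calc _ = β * boolDist xhat x := by simp; ring
      _ ≤ _ := by gcongr

lemma eval_sub_linearize (q : MvPolynomial (Fin n) ℝ) (xhat : Fin n → Bool) (x : Fin n → ℝ) :
    MvPolynomial.eval x q - linearize q xhat x =
      ∑ j, x j * (MvPolynomial.eval x (component q j) - objective (component q j) xhat) := by
  rw [eval_eq_linear_combination, linearize, add_sub_add_left_eq_sub, ← Finset.sum_sub_distrib]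
  exact Finset.sum_congr rfl fun j _ => by ring

lemma abs_eval_sub_linearize_le {q : MvPolynomial (Fin n) ℝ} {xhat : Fin n → Bool} {x : Fin n → ℝ}
    (hx : ∀ i, 0 ≤ x i ∧ x i ≤ 1) {B : ℝ}
    (hB : ∀ j, |MvPolynomial.eval x (component q j) - objective (component q j) xhat| ≤ B) :
    |MvPolynomial.eval x q - linearize q xhat x| ≤ n * B := by
  rw [eval_sub_linearize]
  calc _ ≤ ∑ j : Fin n, B := by
        refine (Finset.abs_sum_le_sum_abs _ _).trans (Finset.sum_le_sum fun j _ => ?_)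
        rw [abs_mul, abs_of_nonneg (hx j).1]
        exact (mul_le_of_le_one_left (abs_nonneg _) (hx j).2).trans (hB j)
    _ = _ := by simp

/-- Passing from a polynomial to its n components multiplies their error by n and adds one tolerance
at the top. Each of the D levels thus contributes A n^D; below them the components are constant. -/
lemma abs_eval_sub_objective_le {xhat : Fin n → Bool} {x : Fin n → ℝ}
    (hx : ∀ i, 0 ≤ x i ∧ x i ≤ 1) {A : ℝ} (D : ℕ) :
    ∀ q : MvPolynomial (Fin n) ℝ, q.totalDegree ≤ D →
      (∀ I : List (Fin n), I.length < D →
        |linearize (componentAt q I) xhat x - objective (componentAt q I) xhat| ≤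
          A * (n : ℝ) ^ (D - I.length)) →
      |MvPolynomial.eval x q - objective q xhat| ≤ D * (A * (n : ℝ) ^ D) := by
  induction D with
  | zero =>
    intro q hq _
    rw [MvPolynomial.totalDegree_eq_zero_iff_eq_C.1 (Nat.le_zero.1 hq)]
    simp [objective]
  | succ D ih =>
    intro q hq h
    have h1 : |MvPolynomial.eval x q - linearize q xhat x| ≤ n * (D * (A * (n : ℝ) ^ D)) := by
      refine abs_eval_sub_linearize_le hx fun j => ih _ (totalDegree_component_le hq j) ?_
      intro I hI
      have := h (j :: I) (by simpa using hI)
      simpa [componentAt] using this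
    have h2 := h [] (Nat.succ_pos D)
    simp only [componentAt, List.length_nil, Nat.sub_zero] at h2
    calc _ ≤ |MvPolynomial.eval x q - linearize q xhat x| +
          |linearize q xhat x - objective q xhat| := abs_sub_le _ _ _
      _ ≤ n * (D * (A * (n : ℝ) ^ D)) + A * (n : ℝ) ^ (D + 1) := add_le_add h1 h2
      _ = _ := by push_cast; ring

lemma abs_eval_sub_linearize_le_of_mem {β : ℝ} (hβ : 0 ≤ β) {d : ℕ} {p : MvPolynomial (Fin n) ℝ}
    (hp : p.totalDegree ≤ d) {xhat : Fin n → Bool} {ε : ℝ} (hε : ε ≤ n) {x : Fin n → ℝ}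
    (hx : x ∈ relaxFeasible β d p xhat ε) :
    |MvPolynomial.eval x p - linearize p xhat x| ≤ d * (errorUnit n β ε * (n : ℝ) ^ d) := by
  -- The program has no constraint for the empty tuple, so p is compared with its linearization and
  -- the recursion starts at the components p_j.
  refine (abs_eval_sub_linearize_le (B := (d - 1 : ℕ) * (errorUnit n β ε * (n : ℝ) ^ (d - 1)))
    hx.1 fun j => ?_).trans ?_
  · refine abs_eval_sub_objective_le hx.1 (d - 1) _ (totalDegree_component_le hp j) fun I hI => ?_
    refine (hx.2 (j :: I) (by simp) (by simp; omega)).trans ?_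
    refine (tolerance_le hβ hε (by simp; omega)).trans ?_
    rw [List.length_cons, Nat.add_comm, Nat.sub_add_eq]
  · have hA : 0 ≤ errorUnit n β ε := errorUnit_nonneg hβ ε
    rcases d with _ | d
    · simp
    · simp only [Nat.add_sub_cancel]
      calc _ = d * (errorUnit n β ε * (n : ℝ) ^ (d + 1)) := by ring
        _ ≤ _ := by gcongr; simp

/-- If the optimal solution is feasible, then the solution of the relaxation is almost as good. -/
lemma IsRelaxOptimal.objective_sub_le {β : ℝ} (hβ : 0 ≤ β) {d : ℕ} {p : MvPolynomial (Fin n) ℝ}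
    (hp : p.totalDegree ≤ d) {xhat : Fin n → Bool} {ε : ℝ} (hε : ε ≤ n) {y x : Fin n → ℝ}
    (hy : IsRelaxOptimal β d p xhat ε y) (hx : x ∈ relaxFeasible β d p xhat ε) :
    MvPolynomial.eval x p - MvPolynomial.eval y p ≤
      2 * (d * (errorUnit n β ε * (n : ℝ) ^ d)) := by
  have h1 := abs_le.1 (abs_eval_sub_linearize_le_of_mem hβ hp hε hx)
  have h2 := abs_le.1 (abs_eval_sub_linearize_le_of_mem hβ hp hε hy.1)
  have h3 : linearize p xhat x ≤ linearize p xhat y := hy.2 hx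
  linarith [h1.2, h2.1]

/-! ### Randomized rounding -/

lemma roundingProb_nonneg {y : Fin n → ℝ} (hy : ∀ i, 0 ≤ y i ∧ y i ≤ 1) (z : Fin n → Bool) :
    0 ≤ roundingProb y z := by
  refine Finset.prod_nonneg fun i _ => ?_
  split_ifs
  · exact (hy i).1
  · linarith [(hy i).2]

lemma sum_roundingProb_mul_prod (y : Fin n → ℝ) (g : Fin n → Bool → ℝ) :
    ∑ z, roundingProb y z * ∏ i, g i (z i) =
      ∏ i, (y i * g i true + (1 - y i) * g i false) := by
  simp only [roundingProb, ← Finset.prod_mul_distrib]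
  rw [← Fintype.prod_sum fun i b => (if b then y i else 1 - y i) * g i b]
  simp

lemma sum_roundingProb (y : Fin n → ℝ) : ∑ z, roundingProb y z = 1 := by
  have := sum_roundingProb_mul_prod y fun _ _ => 1
  simpa using this

lemma sum_prod_roundingProb {ι : Type*} [Fintype ι] [DecidableEq ι] (y : ι → Fin n → ℝ) :
    ∑ z : ι → Fin n → Bool, ∏ e, roundingProb (y e) (z e) = 1 := by
  rw [← Fintype.prod_sum fun e w => roundingProb (y e) w]
  simp [sum_roundingProb]

/-- The coins of different budgets are independent, so all factors except the one at e sum to 1.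
This isolates the one budget that is right. -/
lemma sum_prod_roundingProb_mul {ι : Type*} [Fintype ι] [DecidableEq ι] (y : ι → Fin n → ℝ)
    (e : ι) (g : (Fin n → Bool) → ℝ) :
    ∑ z : ι → Fin n → Bool, (∏ e, roundingProb (y e) (z e)) * g (z e) =
      ∑ w, roundingProb (y e) w * g w := by
  have h : ∀ z : ι → Fin n → Bool, (∏ e, roundingProb (y e) (z e)) * g (z e) =
      ∏ e', roundingProb (y e') (z e') * (if e' = e then g (z e') else 1) := by
    intro z
    rw [Finset.prod_mul_distrib, Finset.prod_ite_eq' Finset.univ e fun e' => g (z e')]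
    simp
  simp only [h]
  rw [← Fintype.prod_sum fun e' w => roundingProb (y e') w * (if e' = e then g w else 1)]
  rw [Finset.prod_eq_single e]
  · simp
  · intro b _ hb
    simp [hb, sum_roundingProb]
  · simp

/-- The expected value of an affine-in-each-variable function under independent rounding. -/
lemma sum_roundingProb_mul_of_affine : ∀ {n : ℕ} (y : Fin n → ℝ) (g : (Fin n → ℝ) → ℝ),
    (∀ k x, ∃ a b : ℝ, ∀ t, g (Function.update x k t) = a * t + b) →
      ∑ z, roundingProb y z * g (boolVec z) = g y
  | 0, y, g, _ => by
    simp only [roundingProb, Finset.univ_eq_empty, Finset.prod_empty, one_mul,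
      Fintype.sum_unique]
    exact congrArg g (Subsingleton.elim _ _)
  | n + 1, y, g, hg => by
    have hcons : ∀ (b : Bool) (z : Fin n → Bool), boolVec (Fin.cons b z : Fin (n + 1) → Bool) =
        Fin.cons (if b then 1 else 0) (boolVec z) := by
      intro b z
      funext i
      refine Fin.cases ?_ (fun i => ?_) i <;> simp [boolVec]
    -- Induction on the number of variables: the first coordinate is frozen at t while the others
    -- are averaged.
    have ih : ∀ t : ℝ, ∑ z, roundingProb (Fin.tail y) z * g (Fin.cons t (boolVec z)) =
        g (Fin.cons t (Fin.tail y)) := by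
      intro t
      refine sum_roundingProb_mul_of_affine (Fin.tail y) (fun x => g (Fin.cons t x)) ?_
      intro k x
      obtain ⟨a, b, h⟩ := hg k.succ (Fin.cons t x)
      exact ⟨a, b, fun s => by rw [Fin.cons_update, h]⟩
    rw [← (Fin.consEquiv fun _ => Bool).sum_comp, Fintype.sum_prod_type]
    have hprob : ∀ (b : Bool) (z : Fin n → Bool),
        roundingProb y (Fin.cons b z : Fin (n + 1) → Bool) =
          (if b then y 0 else 1 - y 0) * roundingProb (Fin.tail y) z := by
      intro b z
      simp [roundingProb, Fin.prod_univ_succ, Fin.tail]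
    change ∑ b : Bool, ∑ z : Fin n → Bool, roundingProb y (Fin.cons b z : Fin (n + 1) → Bool) *
      g (boolVec (Fin.cons b z : Fin (n + 1) → Bool)) = g y
    simp only [hcons, hprob, mul_assoc, ← Finset.mul_sum, ih]
    obtain ⟨a, b, h⟩ := hg 0 y
    have h' : ∀ t : ℝ, g (Fin.cons t (Fin.tail y)) = a * t + b := by
      intro t
      rw [← h t]
      conv_rhs => rw [← Fin.cons_self_tail y, Fin.update_cons_zero]
    rw [Fintype.sum_bool, h' (if true then 1 else 0), h' (if false then 1 else 0)]
    have h0 := h' (y 0)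
    rw [Fin.cons_self_tail] at h0
    rw [h0]
    simp
    ring

/-- A monomial with a square factor is some x_i² times a monomial of degree two less, which leaves
one power of n fewer than for all monomials. In degree 1 there are none. -/
lemma card_exponents_filter_le {d l : ℕ} (hl : l < d) :
    (((exponents n (l + 1)).filter fun m => ∃ i, 2 ≤ m i).card : ℝ) * (n : ℝ) ^ (d - (l + 1)) ≤
      (n : ℝ) ^ (d - 1) := by
  rcases l with _ | l
  · rw [Finset.card_eq_zero.2, Nat.cast_zero, zero_mul]
    · positivity
    · refine Finset.filter_eq_empty_iff.2 fun m hm ⟨i, hi⟩ => ?_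
      have h := Finsupp.le_degree i m
      rw [mem_exponents.1 hm] at h
      omega
  · have h : ((exponents n (l + 2)).filter fun m => ∃ i, 2 ≤ m i).card ≤ n * n ^ l := by
      calc _ ≤ (((Finset.univ : Finset (Fin n)) ×ˢ exponents n l).image
              fun q => Finsupp.single q.1 2 + q.2).card := by
            refine Finset.card_le_card fun m hm => ?_
            obtain ⟨hm, i, hi⟩ := Finset.mem_filter.1 hm
            have hle : Finsupp.single i 2 ≤ m := by simpa using hi
            rw [Finset.mem_image]
            refine ⟨(i, m - Finsupp.single i 2), ?_, add_tsub_cancel_of_le hle⟩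
            have h2 := congrArg Finsupp.degree (add_tsub_cancel_of_le hle)
            rw [map_add, Finsupp.degree_single, mem_exponents.1 hm] at h2
            simp only [Finset.mem_product, Finset.mem_univ, true_and, mem_exponents]
            omega
        _ ≤ _ := Finset.card_image_le
        _ ≤ _ := by
            rw [Finset.card_product, Finset.card_univ, Fintype.card_fin]
            exact Nat.mul_le_mul_left _ (card_exponents_le l)
    have h' : (((exponents n (l + 2)).filter fun m => ∃ i, 2 ≤ m i).card : ℝ) ≤
        (n : ℝ) ^ (l + 1) := by
      rw [pow_succ']
      exact_mod_cast h
    calc _ ≤ (n : ℝ) ^ (l + 1) * (n : ℝ) ^ (d - (l + 2)) := by gcongr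
      _ = _ := by rw [← pow_add]; congr 1; omega

/-- The bias of independent rounding, which only affects the monomials that are not squarefree. -/
lemma IsSmooth.abs_sum_roundingProb_sub_le {β : ℝ} (hβ : 0 ≤ β) {d : ℕ}
    {p : MvPolynomial (Fin n) ℝ} (hp : IsSmooth β d p) {y : Fin n → ℝ}
    (hy : ∀ i, 0 ≤ y i ∧ y i ≤ 1) :
    |∑ z, roundingProb y z * objective p z - MvPolynomial.eval y p| ≤
      d * (β * (n : ℝ) ^ (d - 1)) := by
  -- `r m` is the bias on a single monomial. A coin satisfies z^k = z for k ≥ 1; exponent 0 is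
  -- covered by 0 ^ 0 = 1.
  set r : (Fin n →₀ ℕ) → ℝ := fun m => (∏ i, (y i * 1 ^ m i + (1 - y i) * 0 ^ m i)) -
    ∏ i, y i ^ m i with hr
  have hE : ∑ z, roundingProb y z * objective p z - MvPolynomial.eval y p =
      ∑ l ∈ Finset.range (d + 1), ∑ m ∈ exponents n l, p.coeff m * r m := by
    simp only [objective, eval_eq_sum_exponents hp.1, Finset.mul_sum]
    rw [Finset.sum_comm, ← Finset.sum_sub_distrib]
    refine Finset.sum_congr rfl fun l _ => ?_
    rw [Finset.sum_comm, ← Finset.sum_sub_distrib]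
    refine Finset.sum_congr rfl fun m _ => ?_
    have h := sum_roundingProb_mul_prod y fun i b => (if b then 1 else 0) ^ m i
    simp only [if_true, Bool.false_eq_true, if_false] at h
    rw [hr, mul_sub, ← h, Finset.mul_sum]
    congr 1
    refine Finset.sum_congr rfl fun z _ => ?_
    simp only [boolVec]
    ring
  have hr0 : ∀ m, (¬ ∃ i, 2 ≤ m i) → r m = 0 := by
    intro m hm
    push Not at hm
    rw [hr]
    refine sub_eq_zero.2 (Finset.prod_congr rfl fun i _ => ?_)
    have := hm i
    interval_cases m i <;> simp
  have hr1 : ∀ m, |r m| ≤ 1 := by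
    intro m
    have h1 : ∀ i, 0 ≤ y i * 1 ^ m i + (1 - y i) * 0 ^ m i ∧
        y i * 1 ^ m i + (1 - y i) * 0 ^ m i ≤ 1 := by
      intro i
      have := hy i
      rcases Nat.eq_zero_or_pos (m i) with h | h
      · simp [h]
      · simp [zero_pow h.ne', this]
    have h2 : ∀ i, 0 ≤ y i ^ m i ∧ y i ^ m i ≤ 1 := fun i =>
      ⟨pow_nonneg (hy i).1 _, pow_le_one₀ (hy i).1 (hy i).2⟩
    have a1 := Finset.prod_nonneg fun i (_ : i ∈ Finset.univ) => (h1 i).1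
    have a2 := Finset.prod_le_one (fun i (_ : i ∈ Finset.univ) => (h1 i).1) fun i _ => (h1 i).2
    have b1 := Finset.prod_nonneg fun i (_ : i ∈ Finset.univ) => (h2 i).1
    have b2 := Finset.prod_le_one (fun i (_ : i ∈ Finset.univ) => (h2 i).1) fun i _ => (h2 i).2
    rw [hr, abs_le]
    constructor <;> linarith
  have hfilter : ∀ l, ∑ m ∈ exponents n l, p.coeff m * r m =
      ∑ m ∈ (exponents n l).filter (fun m => ∃ i, 2 ≤ m i), p.coeff m * r m := by
    intro l
    refine (Finset.sum_filter_of_ne fun m _ hm => ?_).symm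
    by_contra h
    exact hm (by rw [hr0 m h, mul_zero])
  -- Degree 0 has no bias; splitting it off leaves d degrees, hence the factor d.
  rw [hE, Finset.sum_range_succ']
  have h0 : ∑ m ∈ exponents n 0, p.coeff m * r m = 0 := by
    refine Finset.sum_eq_zero fun m hm => ?_
    rw [hr0, mul_zero]
    rintro ⟨i, hi⟩
    have h := Finsupp.le_degree i m
    rw [mem_exponents.1 hm] at h
    omega
  rw [h0, add_zero]
  calc _ ≤ ∑ l ∈ Finset.range d, β * (n : ℝ) ^ (d - 1) := by
        refine (Finset.abs_sum_le_sum_abs _ _).trans (Finset.sum_le_sum fun l hl => ?_)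
        rw [Finset.mem_range] at hl
        rw [hfilter]
        calc _ ≤ (((exponents n (l + 1)).filter fun m => ∃ i, 2 ≤ m i).card : ℝ) *
              (β * (n : ℝ) ^ (d - (l + 1))) := by
              rw [← nsmul_eq_mul]
              refine (Finset.abs_sum_le_sum_abs _ _).trans
                (Finset.sum_le_card_nsmul _ _ _ fun m hm => ?_)
              have hm' := mem_exponents.1 (Finset.mem_filter.1 hm).1
              have h := hp.2 m (by omega)
              rw [hm'] at h
              rw [abs_mul]
              exact (mul_le_of_le_one_right (abs_nonneg _) (hr1 m)).trans h
          _ = β * ((((exponents n (l + 1)).filter fun m => ∃ i, 2 ≤ m i).card : ℝ) *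
              (n : ℝ) ^ (d - (l + 1))) := by ring
          _ ≤ _ := by
              gcongr
              exact card_exponents_filter_le hl
    _ = _ := by simp

/-! ### Greedy rounding -/

lemma greedyStep_mem {tie : Fin n → Bool} {p : MvPolynomial (Fin n) ℝ} {y : Fin n → ℝ}
    (hy : ∀ i, 0 ≤ y i ∧ y i ≤ 1) (k i : Fin n) :
    0 ≤ greedyStep tie p y k i ∧ greedyStep tie p y k i ≤ 1 := by
  unfold greedyStep
  dsimp only
  split_ifs <;> by_cases h : i = k
  · subst h; simp
  · simpa [h] using hy i
  · subst h; simp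
  · simpa [h] using hy i

/-- On [0,1] an affine function attains its maximum at an endpoint, and the step picks the better
endpoint. -/
lemma eval_le_eval_greedyStep {tie : Fin n → Bool} {p : MvPolynomial (Fin n) ℝ}
    (hp : IsMultilinear p) {y : Fin n → ℝ} (hy : ∀ i, 0 ≤ y i ∧ y i ≤ 1) (k : Fin n) :
    MvPolynomial.eval y p ≤ MvPolynomial.eval (greedyStep tie p y k) p := by
  obtain ⟨a, b, h⟩ := hp k y
  have hyk := hy k
  have h0 := h (y k)
  rw [Function.update_eq_self] at h0
  unfold greedyStep
  dsimp only
  rw [h0]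
  split_ifs with hc
  · rw [h 0, h 1] at hc
    rw [h 1]
    have : 0 ≤ a := by rcases hc with hc | ⟨hc, _⟩ <;> linarith
    nlinarith
  · rw [h 0, h 1] at hc
    rw [h 0]
    have : a ≤ 0 := by
      by_contra h'
      exact hc (Or.inl (by linarith))
    nlinarith

lemma foldl_greedyStep_mem {tie : Fin n → Bool} {p : MvPolynomial (Fin n) ℝ} (L : List (Fin n)) :
    ∀ {y : Fin n → ℝ}, (∀ i, 0 ≤ y i ∧ y i ≤ 1) →
      ∀ i, 0 ≤ L.foldl (greedyStep tie p) y i ∧ L.foldl (greedyStep tie p) y i ≤ 1 := by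
  induction L with
  | nil => exact fun hy => hy
  | cons k L ih => exact fun hy => ih (greedyStep_mem hy k)

lemma eval_le_eval_foldl_greedyStep {tie : Fin n → Bool} {p : MvPolynomial (Fin n) ℝ}
    (hp : IsMultilinear p) (L : List (Fin n)) :
    ∀ {y : Fin n → ℝ}, (∀ i, 0 ≤ y i ∧ y i ≤ 1) →
      MvPolynomial.eval y p ≤ MvPolynomial.eval (L.foldl (greedyStep tie p) y) p := by
  induction L with
  | nil => exact fun _ => le_rfl
  | cons k L ih =>
    exact fun hy => (eval_le_eval_greedyStep hp hy k).trans (ih (greedyStep_mem hy k))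

/-! ### The value of the pipeline -/

lemma eval_le_bestValue (p : MvPolynomial (Fin n) ℝ) (z : Fin (n + 1) → Fin n → ℝ)
    (e : Fin (n + 1)) : MvPolynomial.eval (z e) p ≤ bestValue p z :=
  Finset.le_sup' (fun e => MvPolynomial.eval (z e) p) (Finset.mem_univ e)

lemma IsSmooth.abs_bestValue_le {β : ℝ} (hβ : 0 ≤ β) {d : ℕ} {p : MvPolynomial (Fin n) ℝ}
    (hp : IsSmooth β d p) {z : Fin (n + 1) → Fin n → ℝ}
    (hz : ∀ e i, 0 ≤ z e i ∧ z e i ≤ 1) : |bestValue p z| ≤ (d + 1) * β * (n : ℝ) ^ d := by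
  obtain ⟨e, _, he⟩ := Finset.exists_mem_eq_sup' (Finset.univ_nonempty (α := Fin (n + 1)))
    fun e => MvPolynomial.eval (z e) p
  rw [bestValue, he]
  exact hp.abs_eval_le hβ (hz e)

/-- Serves twice: for integrability, and as the trivial bound when n is small. -/
lemma IsSmooth.abs_pipelineValue_le {β : ℝ} (hβ : 0 ≤ β) {d : ℕ} {p : MvPolynomial (Fin n) ℝ}
    (hp : IsSmooth β d p) {y : Fin (n + 1) → Fin n → ℝ}
    (hy : ∀ e i, 0 ≤ y e i ∧ y e i ≤ 1) (s : Strategy n) :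
    |pipelineValue p y s| ≤ (d + 1) * β * (n : ℝ) ^ d := by
  cases s with
  | randomized =>
    have hw : ∀ z : Fin (n + 1) → Fin n → Bool, 0 ≤ ∏ e, roundingProb (y e) (z e) := fun z =>
      Finset.prod_nonneg fun e _ => roundingProb_nonneg (hy e) _
    calc _ ≤ ∑ z : Fin (n + 1) → Fin n → Bool,
          (∏ e, roundingProb (y e) (z e)) * ((d + 1) * β * (n : ℝ) ^ d) := by
          refine (Finset.abs_sum_le_sum_abs _ _).trans (Finset.sum_le_sum fun z _ => ?_)
          rw [abs_mul, abs_of_nonneg (hw z)]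
          exact mul_le_mul_of_nonneg_left
            (hp.abs_bestValue_le hβ fun e => boolVec_mem (z e)) (hw z)
      _ = _ := by rw [← Finset.sum_mul, sum_prod_roundingProb, one_mul]
  | greedy tie => exact hp.abs_bestValue_le hβ fun e => foldl_greedyStep_mem _ (hy e)

lemma sum_roundingProb_le_pipelineValue {p : MvPolynomial (Fin n) ℝ}
    {y : Fin (n + 1) → Fin n → ℝ} (hy : ∀ e i, 0 ≤ y e i ∧ y e i ≤ 1) (e : Fin (n + 1)) :
    ∑ z, roundingProb (y e) z * objective p z ≤ pipelineValue p y .randomized := by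
  rw [← sum_prod_roundingProb_mul y e (objective p)]
  refine Finset.sum_le_sum fun z _ => mul_le_mul_of_nonneg_left ?_
    (Finset.prod_nonneg fun e _ => roundingProb_nonneg (hy e) _)
  exact eval_le_bestValue p (fun e => boolVec (z e)) e

lemma IsMultilinear.eval_le_pipelineValue {p : MvPolynomial (Fin n) ℝ} (hp : IsMultilinear p)
    {y : Fin (n + 1) → Fin n → ℝ} (hy : ∀ e i, 0 ≤ y e i ∧ y e i ≤ 1) (s : Strategy n)
    (e : Fin (n + 1)) : MvPolynomial.eval (y e) p ≤ pipelineValue p y s := by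
  cases s with
  | randomized =>
    refine le_trans (le_of_eq ?_) (sum_roundingProb_le_pipelineValue hy e)
    exact (sum_roundingProb_mul_of_affine (y e) (fun x => MvPolynomial.eval x p) hp).symm
  | greedy tie =>
    exact (eval_le_eval_foldl_greedyStep hp _ (hy e)).trans
      (eval_le_bestValue p (fun e => greedyRound tie p (y e)) e)

lemma IsSmooth.eval_sub_le_pipelineValue {β : ℝ} (hβ : 0 ≤ β) {d : ℕ}
    {p : MvPolynomial (Fin n) ℝ} (hp : IsSmooth β d p) {y : Fin (n + 1) → Fin n → ℝ}
    (hy : ∀ e i, 0 ≤ y e i ∧ y e i ≤ 1) (e : Fin (n + 1)) :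
    MvPolynomial.eval (y e) p - d * (β * (n : ℝ) ^ (d - 1)) ≤ pipelineValue p y .randomized := by
  have h1 := abs_le.1 (hp.abs_sum_roundingProb_sub_le hβ (hy e))
  have h2 := sum_roundingProb_le_pipelineValue (p := p) hy e
  linarith [h1.1]

/-- The loss on one instance: `V` is the value of a rounding procedure that loses at most `N`. -/
lemma IsSmooth.objective_sub_le {β : ℝ} (hβ : 0 ≤ β) {d : ℕ} {p : MvPolynomial (Fin n) ℝ}
    (hp : IsSmooth β d p) {xhat x : Fin n → Bool} {y : Fin (n + 1) → Fin n → ℝ}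
    (hy : ∀ e : Fin (n + 1), IsRelaxOptimal β d p xhat ((e : ℕ) : ℝ) (y e)) {V N : ℝ} (hN : 0 ≤ N)
    (hV : |V| ≤ (d + 1) * β * (n : ℝ) ^ d)
    (hVy : ∀ e, MvPolynomial.eval (y e) p - N ≤ V) :
    objective p x - V ≤ (4 * d * β * Real.exp 1 + 4 * (d + 1) * β * d) *
      ((n : ℝ) ^ ((d : ℝ) - 1 / 2) * √(boolDist xhat x)) + N := by
  have hnn : (0 : ℝ) ≤ (n : ℝ) ^ ((d : ℝ) - 1 / 2) * √(boolDist xhat x) := by positivity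
  by_cases h : boolDist xhat x = 0 ∨ 2 * d ^ 2 ≤ n
  · obtain ⟨e, he⟩ := exists_eq_boolDist xhat x
    have hye := hy e
    rw [he] at hye
    have h1 := hye.objective_sub_le hβ hp.1 (boolDist_le xhat x)
      (boolVec_mem_relaxFeasible hβ hp xhat x h)
    have h2 : 2 * (d * (errorUnit n β (boolDist xhat x) * (n : ℝ) ^ d)) =
        4 * d * β * Real.exp 1 * ((n : ℝ) ^ ((d : ℝ) - 1 / 2) * √(boolDist xhat x)) := by
      rcases Nat.eq_zero_or_pos n with rfl | hn
      · have h : √(boolDist xhat x) = 0 :=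
          Real.sqrt_eq_zero_of_nonpos (by simpa using boolDist_le xhat x)
        simp [h, errorUnit]
      · rw [errorUnit, Real.rpow_sub (by exact_mod_cast hn), Real.rpow_natCast,
          ← Real.sqrt_eq_rpow]
        ring
    have h3 := hVy e
    have h4 : 0 ≤ 4 * (d + 1) * β * d *
        ((n : ℝ) ^ ((d : ℝ) - 1 / 2) * √(boolDist xhat x)) := by positivity
    rw [objective]
    linarith
  -- Small n and a wrong prediction: the trivial bounds on both values give 2(d+1)β n^d, which is
  -- absorbed using √n ≤ 2d and ε ≥ 1.
  · push Not at h
    obtain ⟨h0, hnd⟩ := h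
    have hpos : 0 < boolDist xhat x := lt_of_le_of_ne (boolDist_nonneg _ _) h0.symm
    have hn : (0 : ℝ) < n := lt_of_lt_of_le hpos (boolDist_le _ _)
    -- A positive Hamming distance is a positive integer.
    have h1 : (1 : ℝ) ≤ √(boolDist xhat x) := by
      rw [Real.one_le_sqrt]
      rw [boolDist_eq_card] at hpos ⊢
      exact_mod_cast (by exact_mod_cast hpos : 0 < _)
    have h2 : √(n : ℝ) ≤ 2 * d := by
      rw [Real.sqrt_le_left (by positivity)]
      have : (n : ℝ) ≤ 2 * d ^ 2 := by exact_mod_cast hnd.le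
      nlinarith [sq_nonneg (d : ℝ)]
    have h3 : (n : ℝ) ^ d ≤ 2 * d * ((n : ℝ) ^ ((d : ℝ) - 1 / 2) * √(boolDist xhat x)) := by
      calc (n : ℝ) ^ d = √n * (n : ℝ) ^ ((d : ℝ) - 1 / 2) := by
            rw [Real.rpow_sub hn, Real.rpow_natCast, ← Real.sqrt_eq_rpow]
            field_simp
        _ ≤ 2 * d * (n : ℝ) ^ ((d : ℝ) - 1 / 2) := by gcongr
        _ ≤ 2 * d * ((n : ℝ) ^ ((d : ℝ) - 1 / 2) * √(boolDist xhat x)) := by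
            gcongr
            exact le_mul_of_one_le_right (by positivity) h1
    have h4 := (abs_le.1 (hp.abs_eval_le hβ (boolVec_mem x))).2
    have h5 := (abs_le.1 hV).1
    have h6 : 2 * ((d + 1) * β * (n : ℝ) ^ d) ≤ 2 * ((d + 1) * β *
        (2 * d * ((n : ℝ) ^ ((d : ℝ) - 1 / 2) * √(boolDist xhat x)))) := by gcongr
    have h7 : 0 ≤ 4 * d * β * Real.exp 1 *
        ((n : ℝ) ^ ((d : ℝ) - 1 / 2) * √(boolDist xhat x)) := by positivity
    rw [objective]
    linarith

section Learning

variable {Inst : Type*} [MeasurableSpace Inst]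

/-! ### Measurability -/

lemma measurable_eval {d : ℕ} {p : Inst → MvPolynomial (Fin n) ℝ}
    (hd : ∀ π, (p π).totalDegree ≤ d) (hp : ∀ m : Fin n →₀ ℕ, Measurable fun π => (p π).coeff m)
    {x : Inst → Fin n → ℝ} (hx : Measurable x) :
    Measurable fun π => MvPolynomial.eval (x π) (p π) := by
  simp only [fun π => eval_eq_sum_exponents (hd π) (x π)]
  refine Finset.measurable_sum _ fun l _ => Finset.measurable_sum _ fun m _ => (hp m).mul ?_
  exact Finset.measurable_prod _ fun i _ => ((measurable_pi_apply i).comp hx).pow_const _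

lemma measurable_boolVec : Measurable (boolVec : (Fin n → Bool) → Fin n → ℝ) :=
  measurable_of_countable _

lemma measurable_update_const {x : Inst → Fin n → ℝ} (hx : Measurable x) (k : Fin n) (t : ℝ) :
    Measurable fun π => Function.update (x π) k t := by
  refine measurable_pi_lambda _ fun i => ?_
  by_cases h : i = k
  · subst h; simp
  · have hi : Measurable fun π => x π i := (measurable_pi_apply i).comp hx
    simpa [h] using hi

lemma measurable_greedyStep {d : ℕ} {p : Inst → MvPolynomial (Fin n) ℝ}
    (hd : ∀ π, (p π).totalDegree ≤ d) (hp : ∀ m : Fin n →₀ ℕ, Measurable fun π => (p π).coeff m)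
    (tie : Fin n → Bool) (k : Fin n) {x : Inst → Fin n → ℝ} (hx : Measurable x) :
    Measurable fun π => greedyStep tie (p π) (x π) k := by
  have h : ∀ t, Measurable fun π => MvPolynomial.eval (Function.update (x π) k t) (p π) :=
    fun t => measurable_eval hd hp (measurable_update_const hx k t)
  unfold greedyStep
  refine Measurable.ite ?_ (measurable_update_const hx k 1) (measurable_update_const hx k 0)
  exact (measurableSet_lt (h 0) (h 1)).union
    ((measurableSet_eq_fun (h 0) (h 1)).inter (MeasurableSet.const _))

lemma measurable_foldl_greedyStep {d : ℕ} {p : Inst → MvPolynomial (Fin n) ℝ}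
    (hd : ∀ π, (p π).totalDegree ≤ d) (hp : ∀ m : Fin n →₀ ℕ, Measurable fun π => (p π).coeff m)
    (tie : Fin n → Bool) (L : List (Fin n)) :
    ∀ {x : Inst → Fin n → ℝ}, Measurable x →
      Measurable fun π => L.foldl (greedyStep tie (p π)) (x π) := by
  induction L with
  | nil => exact fun hx => hx
  | cons k L ih => exact fun hx => ih (measurable_greedyStep hd hp tie k hx)

lemma measurable_bestValue {d : ℕ} {p : Inst → MvPolynomial (Fin n) ℝ}
    (hd : ∀ π, (p π).totalDegree ≤ d) (hp : ∀ m : Fin n →₀ ℕ, Measurable fun π => (p π).coeff m)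
    {z : Inst → Fin (n + 1) → Fin n → ℝ} (hz : ∀ e, Measurable fun π => z π e) :
    Measurable fun π => bestValue (p π) (z π) := by
  have h := Finset.measurable_sup' (Finset.univ_nonempty (α := Fin (n + 1)))
    (f := fun e π => MvPolynomial.eval (z π e) (p π)) fun e _ => measurable_eval hd hp (hz e)
  convert h using 1
  funext π
  simp [bestValue, Finset.sup'_apply]

lemma measurable_pipelineValue {d : ℕ} {p : Inst → MvPolynomial (Fin n) ℝ}
    (hd : ∀ π, (p π).totalDegree ≤ d) (hp : ∀ m : Fin n →₀ ℕ, Measurable fun π => (p π).coeff m)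
    {y : Inst → Fin (n + 1) → Fin n → ℝ} (hy : ∀ e, Measurable fun π => y π e)
    (s : Strategy n) : Measurable fun π => pipelineValue (p π) (y π) s := by
  cases s with
  | randomized =>
    refine Finset.measurable_sum _ fun z _ => Measurable.mul ?_ ?_
    · refine Finset.measurable_prod _ fun e _ => Finset.measurable_prod _ fun i _ => ?_
      have h : Measurable fun π => y π e i := (measurable_pi_apply i).comp (hy e)
      split_ifs
      · exact h
      · exact measurable_const.sub h
    · exact measurable_bestValue hd hp fun e => measurable_const
  | greedy tie =>
    exact measurable_bestValue hd hp fun e => measurable_foldl_greedyStep hd hp tie _ (hy e)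

/-- There are only finitely many predictions, so measurability for each fixed one already gives
joint measurability. -/
lemma measurable_apply_oracle {y : Inst → (Fin n → Bool) → Fin n → ℝ}
    (hy : ∀ xhat, Measurable fun π => y π xhat) {f : Inst → Fin n → Bool} (hf : Measurable f) :
    Measurable fun π => y π (f π) := by
  have h : Measurable fun q : Inst × (Fin n → Bool) => y q.1 q.2 :=
    measurable_from_prod_countable_left hy
  exact h.comp (measurable_id.prodMk hf)

lemma measurable_boolDist {f g : Inst → Fin n → Bool} (hf : Measurable f) (hg : Measurable g) :
    Measurable fun π => boolDist (f π) (g π) := by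
  have h : Measurable fun q : (Fin n → Bool) × (Fin n → Bool) => boolDist q.1 q.2 :=
    measurable_of_countable _
  exact h.comp (hf.prodMk hg)

/-! ### Expectations -/

lemma integrable_of_abs_le {D : Measure Inst} [IsFiniteMeasure D] {g : Inst → ℝ}
    (hg : Measurable g) {C : ℝ} (hC : ∀ π, |g π| ≤ C) : Integrable g D :=
  Integrable.of_bound hg.aestronglyMeasurable C (Filter.Eventually.of_forall hC)

/-- Jensen's inequality for the concave square root; boundedness supplies the integrability. -/
lemma integral_sqrt_le_sqrt_integral {D : Measure Inst} [IsProbabilityMeasure D] {g : Inst → ℝ}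
    (hg : Measurable g) (h0 : ∀ π, 0 ≤ g π) {C : ℝ} (hC : ∀ π, g π ≤ C) :
    ∫ π, √(g π) ∂D ≤ √(∫ π, g π ∂D) := by
  refine ConcaveOn.le_map_integral (s := Set.Ici 0) (g := fun t : ℝ => √t)
    Real.strictConcaveOn_sqrt.concaveOn Real.continuous_sqrt.continuousOn isClosed_Ici
    (Filter.Eventually.of_forall h0) ?_ ?_
  · exact integrable_of_abs_le hg fun π => by rw [abs_of_nonneg (h0 π)]; exact hC π
  · refine integrable_of_abs_le (C := √C) hg.sqrt fun π => ?_
    rw [Function.comp_apply, abs_of_nonneg (Real.sqrt_nonneg _)]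
    exact Real.sqrt_le_sqrt (hC π)

/-- A pointwise bound on the loss of the reference oracle turns into a bound on the expected
objective value of an oracle of no larger risk. -/
lemma optimalObjective_sub_le {d : ℕ} {β : ℝ} (hβ : 0 ≤ β) {D : Measure Inst}
    [IsProbabilityMeasure D] {p : Inst → MvPolynomial (Fin n) ℝ} (hp : ∀ π, IsSmooth β d (p π))
    (hpm : ∀ m : Fin n →₀ ℕ, Measurable fun π => (p π).coeff m)
    {xstar : Inst → Fin n → Bool} (hx : Measurable xstar) {H : ℝ}
    {y : Inst → (Fin n → Bool) → Fin (n + 1) → Fin n → ℝ}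
    (hy : ∀ π xhat e i, 0 ≤ y π xhat e i ∧ y π xhat e i ≤ 1)
    (hym : ∀ xhat e, Measurable fun π => y π xhat e) {s : Strategy n}
    {f g : Inst → Fin n → Bool} (hf : Measurable f) (hg : Measurable g)
    (hR : risk D H p y s f ≤ risk D H p y s g) {A N : ℝ} (hA : 0 ≤ A)
    (h : ∀ π, objective (p π) (xstar π) - pipelineValue (p π) (y π (g π)) s ≤
      A * √(boolDist (g π) (xstar π)) + N) :
    optimalObjective D p xstar - (A * √(predictionError D xstar g) + N) ≤
      expectedObjective D p y s f := by
  have hint : ∀ f : Inst → Fin n → Bool, Measurable f →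
      Integrable (fun π => pipelineValue (p π) (y π (f π)) s) D := fun f hf =>
    integrable_of_abs_le
      (measurable_pipelineValue (fun π => (hp π).1) hpm
        (fun e => measurable_apply_oracle (fun xhat => hym xhat e) hf) s)
      fun π => (hp π).abs_pipelineValue_le hβ (hy π (f π)) s
  have hopt : Integrable (fun π => objective (p π) (xstar π)) D :=
    integrable_of_abs_le (measurable_eval (fun π => (hp π).1) hpm (measurable_boolVec.comp hx))
      fun π => (hp π).abs_eval_le hβ (boolVec_mem _)
  have hdist := measurable_boolDist hg hx
  have hsqrt : Integrable (fun π => √(boolDist (g π) (xstar π))) D :=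
    integrable_of_abs_le (C := √n) hdist.sqrt fun π => by
      rw [abs_of_nonneg (Real.sqrt_nonneg _)]
      exact Real.sqrt_le_sqrt (boolDist_le _ _)
  -- The constant H cancels in the comparison of risks.
  have h1 : expectedObjective D p y s g ≤ expectedObjective D p y s f := by
    rw [risk, risk, integral_sub (integrable_const _) (hint f hf),
      integral_sub (integrable_const _) (hint g hg)] at hR
    rw [expectedObjective, expectedObjective]
    linarith
  have h2 : optimalObjective D p xstar - expectedObjective D p y s g ≤
      A * ∫ π, √(boolDist (g π) (xstar π)) ∂D + N := by
    rw [optimalObjective, expectedObjective, ← integral_sub hopt (hint g hg)]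
    calc _ ≤ ∫ π, (A * √(boolDist (g π) (xstar π)) + N) ∂D :=
          integral_mono (hopt.sub (hint g hg)) ((hsqrt.const_mul A).add (integrable_const _)) h
      _ = _ := by
          rw [integral_add (hsqrt.const_mul A) (integrable_const _), integral_const_mul]
          simp
  have h3 : ∫ π, √(boolDist (g π) (xstar π)) ∂D ≤ √(predictionError D xstar g) :=
    integral_sqrt_le_sqrt_integral hdist (fun π => boolDist_nonneg _ _) fun π => boolDist_le _ _
  have h4 := mul_le_mul_of_nonneg_left h3 hA
  linarith

end Learning

end SmoothIP

end

theorem mainTheorem9 (d : ℕ) (β : ℝ) (hβ : 0 < β) :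
    ∃ K : ℝ, 0 < K ∧
      ∀ (n : ℕ) (Inst : Type*) [MeasurableSpace Inst]
        (D : Measure Inst) [IsProbabilityMeasure D]
        -- the instances: smooth objectives with their optimal solutions and a common upper bound
        (p : Inst → MvPolynomial (Fin n) ℝ)
        (_ : ∀ π, SmoothIP.IsSmooth β d (p π))
        (_ : ∀ m : Fin n →₀ ℕ, Measurable fun π => (p π).coeff m)
        (xstar : Inst → Fin n → Bool)
        (_ : ∀ π, SmoothIP.IsOptimalSolution (p π) (xstar π))
        (_ : Measurable xstar)
        (H : ℝ)
        (_ : ∀ π, SmoothIP.objective (p π) (xstar π) ≤ H)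
        -- the optimal solutions that the solver returns for the relaxations
        (y : Inst → (Fin n → Bool) → Fin (n + 1) → Fin n → ℝ)
        (_ : ∀ π xhat (e : Fin (n + 1)),
          SmoothIP.IsRelaxOptimal β d (p π) xhat ((e : ℕ) : ℝ) (y π xhat e))
        (_ : ∀ xhat e, Measurable fun π => y π xhat e)
        -- the hypothesis space, the rounding strategy and the two minimizing oracles
        (F : Set (Inst → Fin n → Bool))
        (_ : ∀ f ∈ F, Measurable f)
        (s : SmoothIP.Strategy n)
        (fcost : Inst → Fin n → Bool) (_ : fcost ∈ F)
        (_ : IsMinOn (SmoothIP.risk D H p y s) F fcost)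
        (fpred : Inst → Fin n → Bool) (_ : fpred ∈ F)
        (_ : IsMinOn (SmoothIP.predictionError D xstar) F fpred),
        (s = SmoothIP.Strategy.randomized →
          SmoothIP.expectedObjective D p y s fcost ≥
            SmoothIP.optimalObjective D p xstar
              - K * ((n : ℝ) ^ ((d : ℝ) - 1 / 2) * √(SmoothIP.predictionError D xstar fpred)
                + (n : ℝ) ^ ((d : ℝ) - 1))) ∧
        ((∀ π, SmoothIP.IsMultilinear (p π)) →
          SmoothIP.expectedObjective D p y s fcost ≥
            SmoothIP.optimalObjective D p xstar
              - K * ((n : ℝ) ^ ((d : ℝ) - 1 / 2) *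
                √(SmoothIP.predictionError D xstar fpred))) := by
  -- The summands pay for the relaxation with large n, the trivial bound with small n, and the
  -- rounding bias; the 1 keeps the constant positive when d = 0.
  refine ⟨4 * d * β * Real.exp 1 + 4 * (d + 1) * β * d + d * β + 1, by positivity, ?_⟩
  intro n Inst _ D _ p hp hpm xstar _ hx H _ y hy hym F hF s fcost hfcost hcost fpred hfpred _
  have hβ0 := hβ.le
  set K₁ : ℝ := 4 * d * β * Real.exp 1 + 4 * (d + 1) * β * d with hK₁
  have hK₁0 : 0 ≤ K₁ := by positivity
  have hy01 : ∀ π xhat e i, 0 ≤ y π xhat e i ∧ y π xhat e i ≤ 1 :=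
    fun π xhat e => (hy π xhat e).1.1
  have hR := hcost hfpred
  have ha : (0 : ℝ) ≤ (n : ℝ) ^ ((d : ℝ) - 1 / 2) := by positivity
  set E := √(SmoothIP.predictionError D xstar fpred) with hE
  have hE0 : 0 ≤ E := Real.sqrt_nonneg _
  have hdβ : 0 ≤ d * β := by positivity
  have key : ∀ N : ℝ, 0 ≤ N → (∀ π e, MvPolynomial.eval (y π (fpred π) e) (p π) - N ≤
      SmoothIP.pipelineValue (p π) (y π (fpred π)) s) →
      SmoothIP.optimalObjective D p xstar - (K₁ * (n : ℝ) ^ ((d : ℝ) - 1 / 2) * E + N) ≤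
        SmoothIP.expectedObjective D p y s fcost := by
    intro N hN hV
    refine SmoothIP.optimalObjective_sub_le hβ0 hp hpm hx hy01 hym (hF _ hfcost) (hF _ hfpred) hR
      (by positivity) fun π => ?_
    rw [mul_assoc]
    exact (hp π).objective_sub_le hβ0 (hy π (fpred π)) hN
      ((hp π).abs_pipelineValue_le hβ0 (hy01 π _) s) (hV π)
  refine ⟨?_, fun hmul => ?_⟩
  · rintro rfl
    have h := key (d * (β * (n : ℝ) ^ (d - 1))) (by positivity)
      fun π e => (hp π).eval_sub_le_pipelineValue hβ0 (hy01 π _) e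
    -- For d = 0 the truncated and the real exponent differ, but the factor d makes both sides zero.
    have hn : d * (β * (n : ℝ) ^ (d - 1)) = d * β * (n : ℝ) ^ ((d : ℝ) - 1) := by
      rcases d with _ | d
      · simp
      · rw [Nat.cast_add_one, add_sub_cancel_right, Real.rpow_natCast, Nat.add_sub_cancel]
        ring
    have hb : (0 : ℝ) ≤ (n : ℝ) ^ ((d : ℝ) - 1) := by positivity
    rw [hn] at h
    refine le_trans ?_ h
    have h1 : 0 ≤ (d * β + 1) * ((n : ℝ) ^ ((d : ℝ) - 1 / 2) * E) := by positivity
    have h2 : 0 ≤ (K₁ + 1) * (n : ℝ) ^ ((d : ℝ) - 1) := by positivity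
    nlinarith
  · have h := key 0 le_rfl fun π e => by
      rw [sub_zero]
      exact (hmul π).eval_le_pipelineValue (hy01 π _) s e
    refine le_trans ?_ h
    have h1 : 0 ≤ (d * β + 1) * ((n : ℝ) ^ ((d : ℝ) - 1 / 2) * E) := by positivity
    nlinarith
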